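/- Let $\nu$ and $\mu$ be probability distributions on $\{0,1,2,\dots\}$, both different from $\delta_1$, such that $\nu$ has mean $1$ and finite variance $\Sigma^2$, and $\mu$ has mean $m>0$ and finite variance $\sigma^2$. Let $\mathcal T$ be the (unconditioned) Bienaymé–Galton–Watson plane tree with offspring distribution $\nu$, which is almost surely finite, and conditionally on $\mathcal T$ let i.i.d. numbers of cars with law $\mu$ arrive at the vertices of $\mathcal T$. Every vertex is a parking spot for at most one car. Each car tries to park at its arrival vertex; if that spot is occupied, it drives towards the root $\varnothing$ and parks at the first free vertex it meets, and if there is none it leaves the tree through the root. (The set of vertices occupied at the end does not depend on the order in which the cars are parked.) Put $$\Theta=(1-m)^2-\Sigma^2(\sigma^2+m^2-m).$$ Then: 1. if $m\le 1$ and $\Theta\ge 0$ (subcritical case $\Theta>0$ or critical case $\Theta=0$), then $\mathbb P(\varnothing \text{ holds a car after parking in } \mathcal T)=m$; 2. if $\Theta<0$ or $m>1$ (supercritical case), then $\mathbb P(\varnothing \text{ holds a car after parking in } \mathcal T)<m$. -/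

import Mathlib

open MeasureTheory ProbabilityTheory

namespace Parking

/-- Finite rooted plane trees `𝔱` decorated with a car configuration `ℓ : Vertices(𝔱) → ℕ`.
`node ℓ k child` is the tree whose root receives `ℓ` cars and has `k` children, ordered from left
to right, the `i`-th of which is the root of the decorated plane tree `child i`. -/
inductive CarTree : Type
  | node (ℓ k : ℕ) (child : Fin k → CarTree) : CarTree

/-- The discrete σ-algebra on decorated trees (there are countably many of them). -/
instance : MeasurableSpace CarTree := ⊤

/-! ### The parking process

A vertex is addressed by the list of child indices on its path to the root, the index of the vertex
itself among its siblings coming first. So the root `∅` is `[]`, and the parent of `i :: p` is `p`. -/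

/-- A single car arrives at a vertex, `S` being the set of occupied vertices: it parks there if the
spot is free; otherwise it moves to the parent and tries again. If all the spots down to the root
are taken, then the car leaves the tree and the set of occupied vertices does not change. -/
def parkCar (S : Finset (List ℕ)) : List ℕ → Finset (List ℕ)
  | [] => if [] ∈ S then S else insert [] S
  | i :: p => if i :: p ∈ S then parkCar S p else insert (i :: p) S

theorem parkCar_of_notMem {S : Finset (List ℕ)} {v : List ℕ} (h : v ∉ S) :
    parkCar S v = insert v S := by
  cases v <;> simp [parkCar, h]

theorem subset_parkCar (S : Finset (List ℕ)) (v : List ℕ) : S ⊆ parkCar S v := by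
  induction v with
  | nil => unfold parkCar; split_ifs <;> simp
  | cons i p ih => unfold parkCar; split_ifs <;> simp [ih]

/-- If one of the two spots is free then the order of the two arrivals does not matter, provided
it does not matter for the other one. Auxiliary to `parkCar_comm`. -/
theorem parkCar_comm_of_notMem {S : Finset (List ℕ)} {v : List ℕ} (hv : v ∉ S) (u : List ℕ) :
    parkCar (parkCar S u) v = parkCar (parkCar S v) u := by
  induction u with
  | nil =>
    by_cases hu : [] ∈ S
    · have h1 : parkCar S [] = S := by simp [parkCar, hu]
      have h2 : parkCar (parkCar S v) [] = parkCar S v := by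
        simp [parkCar, subset_parkCar S v hu]
      rw [h1, h2]
    · rcases eq_or_ne v [] with rfl | hne
      · rfl
      · rw [parkCar_of_notMem hu, parkCar_of_notMem hv, parkCar_of_notMem (by simp [hne, hv]),
          parkCar_of_notMem (by simp [hne.symm, hu]), Finset.insert_comm]
  | cons i p ih =>
    by_cases hu : i :: p ∈ S
    · have h1 : parkCar S (i :: p) = parkCar S p := by simp [parkCar, hu]
      have h2 : parkCar (parkCar S v) (i :: p) = parkCar (parkCar S v) p := by
        simp [parkCar, subset_parkCar S v hu]
      rw [h1, h2, ih]
    · rcases eq_or_ne v (i :: p) with rfl | hne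
      · rfl
      · rw [parkCar_of_notMem hu, parkCar_of_notMem hv, parkCar_of_notMem (by simp [hne, hv]),
          parkCar_of_notMem (by simp [hne.symm, hu]), Finset.insert_comm]

/-- The Abelian property: the set of occupied vertices does not depend on the order in which two
cars are parked. -/
theorem parkCar_comm (S : Finset (List ℕ)) (u v : List ℕ) :
    parkCar (parkCar S u) v = parkCar (parkCar S v) u := by
  induction v with
  | nil =>
    by_cases hv : [] ∈ S
    · have h1 : parkCar S [] = S := by simp [parkCar, hv]
      have h2 : parkCar (parkCar S u) [] = parkCar S u := by
        simp [parkCar, subset_parkCar S u hv]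
      rw [h1, h2]
    · exact parkCar_comm_of_notMem hv u
  | cons i p ih =>
    by_cases hv : i :: p ∈ S
    · have h1 : parkCar S (i :: p) = parkCar S p := by simp [parkCar, hv]
      have h2 : parkCar (parkCar S u) (i :: p) = parkCar (parkCar S u) p := by
        simp [parkCar, subset_parkCar S u hv]
      rw [h1, h2, ih]
    · exact parkCar_comm_of_notMem hv u

instance : RightCommutative parkCar := ⟨parkCar_comm⟩

/-- The multiset of the arrival vertices of all the cars: each vertex `x` occurs `ℓ(x)` times. -/
def CarTree.arrivals : CarTree → Multiset (List ℕ)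
  | .node ℓ k child =>
      Multiset.replicate ℓ [] + ∑ i : Fin k, (child i).arrivals.map (fun v => v ++ [(i : ℕ)])

/-- The set of the vertices that hold a car once all the cars, arriving one after the other (in any
order) on an initially empty tree, have been through the parking process. -/
def CarTree.occupied (T : CarTree) : Finset (List ℕ) :=
  Multiset.foldl parkCar ∅ T.arrivals

/-- The root `∅` holds a car after parking. -/
def CarTree.RootOccupied (T : CarTree) : Prop := [] ∈ T.occupied

/-! ### The random tree -/

/-- The probability `∏ₓ ν(kₓ) μ(ℓₓ)` of a given decorated tree, where `x` runs over the vertices, `kₓ`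
is the number of children of `x` and `ℓₓ` the number of cars arriving at `x`. -/
noncomputable def CarTree.weight (ν μ : Measure ℕ) : CarTree → ENNReal
  | .node ℓ k child => ν {k} * μ {ℓ} * ∏ i : Fin k, (child i).weight ν μ

/-- The law of the (unconditioned) Bienaymé--Galton--Watson tree `𝒯` with offspring distribution
`ν`, decorated, conditionally on `𝒯`, with i.i.d. car arrivals of law `μ`. Every finite decorated
tree is given its probability; for critical `ν ≠ δ₁` the tree is almost surely finite, so that
this is the complete law. -/
noncomputable def galtonWatson (ν μ : Measure ℕ) : Measure CarTree :=
  Measure.sum fun T : CarTree => T.weight ν μ • Measure.dirac T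

/-- The mean of a distribution on `ℕ`. -/
noncomputable def mean (ρ : Measure ℕ) : ℝ := ∫ k, (k : ℝ) ∂ρ

/-- The variance of a distribution on `ℕ`. -/
noncomputable def var (ρ : Measure ℕ) : ℝ := variance (fun k : ℕ => (k : ℝ)) ρ

/-- `Θ = (1 - m)² - Σ² (σ² + m² - m)`, with `m`, `σ²` the mean and variance of the car arrivals `μ`
and `Σ²` the variance of the offspring distribution `ν`. -/
noncomputable def theta (ν μ : Measure ℕ) : ℝ :=
  (1 - mean μ) ^ 2 - var ν * (var μ + mean μ ^ 2 - mean μ)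

end Parking

namespace Parking
open Filter
open scoped ENNReal Topology

/-! Let `X` be the number of cars that visit the root and `Z = max (X - 1) 0` the number that leave
the tree. Parking in one child's subtree does not interact with the others, so `X = ℓ + ∑ Z_i` over
the children of the root, and the root ends up occupied iff `X > 0` (`CarTree.rootOccupied_iff`).
Write `q = P(X > 0)`. Since `ν` has mean `1`, `E X = m + E Z`, while `E Z + q = E X` always. Hence
`q = m` as soon as `E Z` is finite.

If `m ≤ 1` and `Θ ≥ 0`, discard the arrivals at height at least `n`, so that all moments used are
finite, and let `a n` be the mean outflow. Comparing second moments, which increase with `n`, gives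
`a (n + 1) ≤ (σ² + m² - m) + (2 m - 1) a n + Σ² (a n)²`. The fixed points of the right side are the
roots of a quadratic with discriminant `4 Θ` and vertex `(1 - m) / Σ²`; the interval from `0` to
this vertex is preserved (`expectedOutflow_le`), so `E Z` is finite.

In general no moment of `Z` is available, so generating functions are used. With `δ = 1 - E[(1 - ε)
^ Z]`, the recursion becomes `ε (m - q) + (1 - m) ε δ = A δ² + B ε²` (`outflowDefect_eq`), where `A
→ Σ² / 2` and `B → (σ² + m² - m) / 2` as `ε → 0`. Dividing by `ε` gives `q ≤ m`. If `q = m`, then `δ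
/ ε` is a real root of a quadratic whose discriminant tends to `Θ`, so `Θ ≥ 0`. Thus `Θ < 0` forces
`q < m`; for `m > 1` the bound `q ≤ 1` is enough. -/

/-! ### Parking: reduction to a recursion on the number of visits to the root -/

/-- The configuration seen in the subtree of the `i`-th child of the root. -/
noncomputable def childConfig (S : Finset (List ℕ)) (i : ℕ) : Finset (List ℕ) :=
  S.preimage (fun v => v ++ [i]) (by intro a _ b _ h; simpa using h)

theorem mem_childConfig {S : Finset (List ℕ)} {i : ℕ} {v : List ℕ} :
    v ∈ childConfig S i ↔ v ++ [i] ∈ S := by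
  exact Finset.mem_preimage

theorem parkCar_eq_self_or (S : Finset (List ℕ)) (v : List ℕ) :
    parkCar S v = S ∨ (parkCar S v).card = S.card + 1 := by
  induction v with
  | nil => by_cases h : [] ∈ S <;> simp [parkCar, h]
  | cons i p ih => by_cases h : i :: p ∈ S <;> simp [parkCar, h, ih]

/-- A car arriving in the subtree of the `i`-th child acts on that subtree as it would on an isolated
tree. -/
theorem childConfig_parkCar_append_self (S : Finset (List ℕ)) (v : List ℕ) (i : ℕ) :
    childConfig (parkCar S (v ++ [i])) i = parkCar (childConfig S i) v := by
  induction v with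
  | nil =>
    ext w
    by_cases h : [i] ∈ S <;> by_cases h' : [] ∈ S <;>
      simp [parkCar, mem_childConfig, h, h']
  | cons j p ih =>
    by_cases h : j :: (p ++ [i]) ∈ S
    · simp [parkCar, mem_childConfig, h, ih]
    · ext w
      have : w ++ [i] = j :: (p ++ [i]) ↔ w = j :: p := by
        rw [← List.cons_append, List.append_left_inj]
      simp [parkCar, mem_childConfig, h, this]

theorem childConfig_parkCar_append_of_ne (S : Finset (List ℕ)) (v : List ℕ) {i j : ℕ} (hij : j ≠ i) :
    childConfig (parkCar S (v ++ [i])) j = childConfig S j := by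
  induction v with
  | nil =>
    ext w
    by_cases h : [i] ∈ S <;> by_cases h' : [] ∈ S <;>
      simp [parkCar, mem_childConfig, h, h', hij, List.append_eq_cons_iff]
  | cons a p ih =>
    by_cases h : a :: (p ++ [i]) ∈ S
    · simp [parkCar, h, ih]
    · ext w
      have : w ++ [j] ≠ a :: (p ++ [i]) := by
        rw [← List.cons_append]
        intro e
        exact hij (by simpa using (List.append_inj' e rfl).2)
      simp [parkCar, mem_childConfig, h, this]

/-- The root gets occupied when a car leaves the subtree of the `i`-th child. -/
theorem nil_mem_parkCar_append (S : Finset (List ℕ)) (v : List ℕ) (i : ℕ) :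
    [] ∈ parkCar S (v ++ [i]) ↔ [] ∈ S ∨ parkCar (childConfig S i) v = childConfig S i := by
  induction v with
  | nil =>
    by_cases h : [i] ∈ S <;> by_cases h' : [] ∈ S <;>
      simp [parkCar, mem_childConfig, h, h']
  | cons a p ih =>
    by_cases h : a :: (p ++ [i]) ∈ S
    · simp [parkCar, mem_childConfig, h, ih]
    · simp [parkCar, mem_childConfig, h]

theorem card_foldl_parkCar_le (A : Multiset (List ℕ)) (S : Finset (List ℕ)) :
    (A.foldl parkCar S).card ≤ S.card + Multiset.card A := by
  induction A using Multiset.induction_on generalizing S with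
  | empty => simp
  | cons v A ih =>
    rw [Multiset.foldl_cons, Multiset.card_cons]
    have := ih (parkCar S v)
    rcases parkCar_eq_self_or S v with h | h
    · rw [h] at this ⊢; omega
    · omega

theorem childConfig_foldl_self (A : Multiset (List ℕ)) (S : Finset (List ℕ)) (i : ℕ) :
    childConfig ((A.map (fun v => v ++ [i])).foldl parkCar S) i =
      A.foldl parkCar (childConfig S i) := by
  induction A using Multiset.induction_on generalizing S with
  | empty => simp
  | cons v A ih => simp [ih, childConfig_parkCar_append_self]

theorem childConfig_foldl_of_ne (A : Multiset (List ℕ)) (S : Finset (List ℕ)) {i j : ℕ}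
    (hij : j ≠ i) :
    childConfig ((A.map (fun v => v ++ [i])).foldl parkCar S) j = childConfig S j := by
  induction A using Multiset.induction_on generalizing S with
  | empty => simp
  | cons v A ih => simp [ih, childConfig_parkCar_append_of_ne _ _ hij]

/-- A car fails to increase the number of occupied spots of the subtree exactly when it leaves that
subtree, so a deficit in the count detects a car reaching the root. -/
theorem nil_mem_foldl_append (A : Multiset (List ℕ)) (S : Finset (List ℕ)) (i : ℕ) :
    [] ∈ (A.map (fun v => v ++ [i])).foldl parkCar S ↔
      [] ∈ S ∨ (A.foldl parkCar (childConfig S i)).card < (childConfig S i).card + Multiset.card A := by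
  induction A using Multiset.induction_on generalizing S with
  | empty => simp
  | cons v A ih =>
    simp only [Multiset.map_cons, Multiset.foldl_cons, Multiset.card_cons, ih,
      nil_mem_parkCar_append, childConfig_parkCar_append_self]
    have hle := card_foldl_parkCar_le A (parkCar (childConfig S i) v)
    rcases parkCar_eq_self_or (childConfig S i) v with h | h
    · rw [h] at hle ⊢
      simp only [or_true, true_or, true_iff]
      right; omega
    · have hne : parkCar (childConfig S i) v ≠ childConfig S i := fun e => by
        rw [e] at h; omega
      simp only [hne, or_false, h]
      rw [add_assoc, add_comm 1]

theorem foldl_parkCar_replicate_nil (ℓ : ℕ) (S : Finset (List ℕ)) :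
    (Multiset.replicate ℓ []).foldl parkCar S = if ℓ = 0 then S else insert [] S := by
  induction ℓ generalizing S with
  | zero => simp
  | succ n ih =>
    rw [Multiset.replicate_succ, Multiset.foldl_cons, ih]
    have : parkCar S [] = insert [] S := by
      by_cases h : [] ∈ S <;> simp [parkCar, h]
    rw [this]
    by_cases h : n = 0 <;> simp [h]

/-- The number of cars that visit the root, parked there or not. -/
def CarTree.visits : CarTree → ℕ
  | .node ℓ k child => ℓ + ∑ i : Fin k, ((child i).visits - 1)

/-- The subtrees are filled one after the other. Cars from one of them never alter the configuration
of another, so each evolves as an isolated tree started empty. -/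
theorem foldl_children_aux {k : ℕ} (A : Fin k → Multiset (List ℕ)) (s : Finset (Fin k)) :
    (∀ j, childConfig ((∑ i ∈ s, (A i).map (fun v => v ++ [(i : ℕ)])).foldl parkCar ∅) j =
      if h : ∃ i ∈ s, (i : ℕ) = j then (A h.choose).foldl parkCar ∅ else ∅) ∧
    ([] ∈ (∑ i ∈ s, (A i).map (fun v => v ++ [(i : ℕ)])).foldl parkCar ∅ ↔
      ∃ i ∈ s, ((A i).foldl parkCar ∅).card < Multiset.card (A i)) := by
  induction s using Finset.induction_on with
  | empty => simp [childConfig]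
  | insert a s ha ih =>
    rw [Finset.sum_insert ha, add_comm, Multiset.foldl_add]
    obtain ⟨ih1, ih2⟩ := ih
    -- The subtree about to be filled is still empty, since only those indexed by `s` have received
    -- cars.
    have h0 : childConfig ((∑ i ∈ s, (A i).map (fun v => v ++ [(i : ℕ)])).foldl parkCar ∅) a = ∅ := by
      rw [ih1, dif_neg]
      rintro ⟨i, hi, h⟩
      exact ha (by rwa [← Fin.ext h])
    refine ⟨fun j => ?_, ?_⟩
    · by_cases hj : j = a
      · subst hj
        have hex : ∃ i ∈ insert a s, (i : ℕ) = a := ⟨a, by simp, rfl⟩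
        rw [childConfig_foldl_self, h0, dif_pos hex]
        rw [show hex.choose = a from Fin.ext hex.choose_spec.2]
      · rw [childConfig_foldl_of_ne _ _ hj, ih1]
        have : (∃ i ∈ insert a s, (i : ℕ) = j) ↔ ∃ i ∈ s, (i : ℕ) = j := by
          simp [Ne.symm hj]
        by_cases h : ∃ i ∈ s, (i : ℕ) = j
        · rw [dif_pos h, dif_pos (this.2 h)]
          congr 2
          exact (Fin.ext (h.choose_spec.2.trans (this.2 h).choose_spec.2.symm))
        · rw [dif_neg h, dif_neg (mt this.1 h)]
    · rw [nil_mem_foldl_append, ih2, h0]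
      simp [or_comm]

theorem card_eq_sum_childConfig (S : Finset (List ℕ)) (k : ℕ) (hS : ∀ j, k ≤ j → childConfig S j = ∅) :
    S.card = (if [] ∈ S then 1 else 0) + ∑ i : Fin k, (childConfig S i).card := by
  classical
  have : S = (if [] ∈ S then {[]} else ∅) ∪
      Finset.univ.biUnion (fun i : Fin k => (childConfig S i).image (fun v => v ++ [(i : ℕ)])) := by
    ext w
    rcases List.eq_nil_or_concat' w with rfl | ⟨v, j, rfl⟩
    · by_cases h : [] ∈ S <;> simp [h]
    · have h1 : v ++ [j] ∉ (if [] ∈ S then ({[]} : Finset (List ℕ)) else ∅) := by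
        split_ifs <;> simp
      rw [Finset.mem_union, or_iff_right h1]
      simp only [Finset.mem_biUnion, Finset.mem_univ, true_and, Finset.mem_image, mem_childConfig]
      constructor
      · intro h
        have hj : j < k := by
          by_contra hj
          have := hS j (by omega)
          rw [← mem_childConfig, this] at h
          simp at h
        exact ⟨⟨j, hj⟩, v, h, rfl⟩
      · rintro ⟨i, u, hu, e⟩
        rwa [← e]
  refine (congrArg Finset.card this).trans ?_
  rw [Finset.card_union_of_disjoint, Finset.card_biUnion]
  · congr 1
    · split_ifs <;> simp
    · refine Finset.sum_congr rfl fun i _ => Finset.card_image_of_injective _ ?_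
      intro a b h; simpa using h
  · intro i _ j _ hij
    rw [Function.onFun, Finset.disjoint_left]
    simp only [Finset.mem_image]
    rintro w ⟨a, _, rfl⟩ ⟨b, _, h⟩
    exact hij (Fin.ext (by simpa using ((List.append_inj' h rfl).2).symm))
  · rw [Finset.disjoint_left]
    intro w hw
    split_ifs at hw with h
    · simp [Finset.mem_singleton.1 hw]
    · simp at hw

/-- The two claims go through the induction together: occupation of the root depends on how many
cars leave each child's subtree, and that number is arrivals minus parked cars. -/
theorem CarTree.rootOccupied_iff_and_card (T : CarTree) :
    (T.RootOccupied ↔ 0 < T.visits) ∧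
      Multiset.card T.arrivals - T.occupied.card = T.visits - 1 := by
  induction T with
  | node ℓ k child ih =>
    set A : Fin k → Multiset (List ℕ) := fun i => (child i).arrivals
    obtain ⟨h1, h2⟩ := foldl_children_aux A Finset.univ
    set S := (∑ i : Fin k, (A i).map (fun v => v ++ [(i : ℕ)])).foldl parkCar ∅ with hSdef
    -- By commutativity the root's own cars may be parked last; they can only fill the root.
    have hocc : (CarTree.node ℓ k child).occupied = if ℓ = 0 then S else insert [] S := by
      rw [CarTree.occupied, CarTree.arrivals, add_comm, Multiset.foldl_add,
        foldl_parkCar_replicate_nil]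
    have hle : ∀ i, (child i).occupied.card ≤ Multiset.card (child i).arrivals := fun i => by
      simpa [CarTree.occupied] using card_foldl_parkCar_le (child i).arrivals ∅
    have hroot : (CarTree.node ℓ k child).RootOccupied ↔ 0 < (CarTree.node ℓ k child).visits := by
      rw [CarTree.RootOccupied, hocc, CarTree.visits]
      have : [] ∈ S ↔ 0 < ∑ i : Fin k, ((child i).visits - 1) := by
        rw [h2, Finset.sum_pos_iff]
        refine exists_congr fun i => and_congr_right fun _ => ?_
        rw [← (ih i).2, Nat.sub_pos_iff_lt]; rfl
      by_cases hℓ : ℓ = 0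
      · simp [hℓ, this]
      · simp [hℓ, Nat.pos_of_ne_zero hℓ]
    refine ⟨hroot, ?_⟩
    have hc : ∀ j, childConfig (CarTree.node ℓ k child).occupied j = childConfig S j := by
      intro j; rw [hocc]; ext w; by_cases hℓ : ℓ = 0 <;> simp [hℓ, mem_childConfig]
    have hcard := card_eq_sum_childConfig (CarTree.node ℓ k child).occupied k (by
      intro j hj
      rw [hc, h1, dif_neg]
      rintro ⟨i, -, h⟩
      have := i.2
      omega)
    have hchild : ∀ i : Fin k, childConfig S i = (child i).occupied := by
      intro i
      have hex : ∃ j ∈ (Finset.univ : Finset (Fin k)), (j : ℕ) = i := ⟨i, by simp, rfl⟩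
      rw [h1, dif_pos hex, show hex.choose = i from Fin.ext hex.choose_spec.2]
      rfl
    have harr : Multiset.card (CarTree.node ℓ k child).arrivals =
        ℓ + ∑ i, (((child i).visits - 1) + (child i).occupied.card) := by
      rw [CarTree.arrivals, Multiset.card_add, Multiset.card_replicate, Multiset.card_sum]
      congr 1
      refine Finset.sum_congr rfl fun i _ => ?_
      rw [Multiset.card_map, ← (ih i).2, Nat.sub_add_cancel (hle i)]
    rw [hcard, harr, Finset.sum_add_distrib, CarTree.visits]
    simp only [hc, hchild]
    have : ([] ∈ (CarTree.node ℓ k child).occupied) ↔ 0 < ℓ + ∑ i, ((child i).visits - 1) := hroot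
    by_cases h : 0 < ℓ + ∑ i, ((child i).visits - 1)
    · rw [if_pos (this.2 h)]; omega
    · rw [if_neg (mt this.1 h)]; omega

theorem CarTree.rootOccupied_iff (T : CarTree) : T.RootOccupied ↔ 0 < T.visits :=
  T.rootOccupied_iff_and_card.1

/-! ### Truncation in height -/

/-- The number of cars that visit the root when only the arrivals at height less than `n` are
taken into account. -/
def CarTree.visitsBelow : ℕ → CarTree → ℕ
  | 0, _ => 0
  | n + 1, .node ℓ k child => ℓ + ∑ i : Fin k, (visitsBelow n (child i) - 1)

theorem CarTree.visitsBelow_mono (T : CarTree) : Monotone fun n => T.visitsBelow n := by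
  refine monotone_nat_of_le_succ fun n => ?_
  induction n generalizing T with
  | zero => simp [visitsBelow]
  | succ n ih =>
    cases T with
    | node ℓ k child =>
      simp only [visitsBelow]
      gcongr with i
      exact ih _

/-- The number of generations. -/
def CarTree.height : CarTree → ℕ
  | .node _ _ child => Finset.univ.sup (fun i => (child i).height) + 1

theorem CarTree.visitsBelow_eq_visits (T : CarTree) {n : ℕ} (hn : T.height ≤ n) :
    T.visitsBelow n = T.visits := by
  induction T generalizing n with
  | node ℓ k child ih =>
    cases n with
    | zero => simp [height] at hn
    | succ n =>
      simp only [height, add_le_add_iff_right, Finset.sup_le_iff] at hn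
      simp only [visitsBelow, visits]
      congr 1
      exact Finset.sum_congr rfl fun i hi => by rw [ih i (hn i hi)]

instance : DiscreteMeasurableSpace CarTree := ⟨fun _ => trivial⟩

/-! ### Sums over tuples with product weights -/

section PiSum
variable {α : Type*} (w : α → ℝ≥0∞)

/-- The sum of `f` over `k`-tuples weighted by the product of the weights of the entries. -/
noncomputable def piSum (k : ℕ) (f : (Fin k → α) → ℝ≥0∞) : ℝ≥0∞ := ∑' c, (∏ i, w (c i)) * f c

theorem piSum_zero (f : (Fin 0 → α) → ℝ≥0∞) : piSum w 0 f = f default := by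
  simp [piSum]

theorem piSum_succ (k : ℕ) (f : (Fin (k + 1) → α) → ℝ≥0∞) :
    piSum w (k + 1) f = ∑' a, w a * piSum w k (fun c => f (Fin.cons a c)) := by
  unfold piSum
  rw [← (Fin.consEquiv fun _ => α).tsum_eq]
  refine (ENNReal.tsum_prod (f := fun a (c : Fin k → α) =>
    (∏ i, w ((Fin.cons a c : Fin (k + 1) → α) i)) * f (Fin.cons a c))).trans ?_
  refine tsum_congr fun a => ?_
  rw [← ENNReal.tsum_mul_left]
  refine tsum_congr fun c => ?_
  simp [Fin.prod_univ_succ, mul_assoc]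

theorem piSum_add (k : ℕ) (f g : (Fin k → α) → ℝ≥0∞) :
    piSum w k (fun c => f c + g c) = piSum w k f + piSum w k g := by
  simp [piSum, mul_add, ENNReal.tsum_add]

theorem piSum_const_mul (k : ℕ) (a : ℝ≥0∞) (f : (Fin k → α) → ℝ≥0∞) :
    piSum w k (fun c => a * f c) = a * piSum w k f := by
  simp [piSum, ← ENNReal.tsum_mul_left, mul_left_comm]

theorem piSum_prod (k : ℕ) (g : α → ℝ≥0∞) :
    piSum w k (fun c => ∏ i, g (c i)) = (∑' a, w a * g a) ^ k := by
  induction k with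
  | zero => simp [piSum_zero]
  | succ k ih =>
    simp only [piSum_succ, Fin.prod_univ_succ, Fin.cons_zero, Fin.cons_succ, piSum_const_mul, ih,
      ← mul_assoc]
    rw [ENNReal.tsum_mul_right, pow_succ']

variable {w}

theorem piSum_one (hw : ∑' a, w a = 1) (k : ℕ) : piSum w k (fun _ => 1) = 1 := by
  have := piSum_prod w k (fun _ => 1)
  simpa [hw] using this

theorem piSum_const (hw : ∑' a, w a = 1) (k : ℕ) (a : ℝ≥0∞) : piSum w k (fun _ => a) = a := by
  have := piSum_const_mul w k a (fun _ => 1)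
  simpa [piSum_one hw] using this

theorem piSum_sum (hw : ∑' a, w a = 1) (k : ℕ) (g : α → ℝ≥0∞) :
    piSum w k (fun c => ∑ i, g (c i)) = k * ∑' a, w a * g a := by
  induction k with
  | zero => simp [piSum_zero]
  | succ k ih =>
    simp only [piSum_succ, Fin.sum_univ_succ, Fin.cons_zero, Fin.cons_succ, piSum_add, ih,
      piSum_const hw, mul_add, ENNReal.tsum_add, ENNReal.tsum_mul_right, hw]
    push_cast
    ring

/-- The `k` diagonal terms give second moments; by independence the `k (k - 1)` off-diagonal ones
give squared means. -/
theorem piSum_sum_sq (hw : ∑' a, w a = 1) (k : ℕ) (g : α → ℝ≥0∞) :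
    piSum w k (fun c => (∑ i, g (c i)) ^ 2) =
      k * ∑' a, w a * g a ^ 2 + (k * (k - 1) : ℕ) * (∑' a, w a * g a) ^ 2 := by
  induction k with
  | zero => simp [piSum_zero]
  | succ k ih =>
    simp only [piSum_succ, Fin.sum_univ_succ, Fin.cons_zero, Fin.cons_succ, add_sq, piSum_add, ih,
      piSum_const hw, piSum_const_mul, piSum_sum hw, mul_add, ENNReal.tsum_add,
      ENNReal.tsum_mul_right, hw]
    have h1 : ∑' a, w a * (2 * g a * (k * ∑' a, w a * g a)) =
        2 * k * (∑' a, w a * g a) ^ 2 := by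
      calc _ = ∑' a, (w a * g a) * (2 * (k * ∑' a, w a * g a)) := tsum_congr fun a => by ring
        _ = _ := by rw [ENNReal.tsum_mul_right]; ring
    have h2 : (k + 1) * (k + 1 - 1) = k * (k - 1) + 2 * k := by
      cases k <;> simp; ring
    rw [h1, h2]
    push_cast
    ring

end PiSum

/-! ### The branching property and its moment identities -/

section Branching
variable (ν μ : Measure ℕ)

theorem lintegral_galtonWatson (f : CarTree → ℝ≥0∞) :
    ∫⁻ T, f T ∂galtonWatson ν μ = ∑' T, T.weight ν μ * f T := by
  simp [galtonWatson, lintegral_sum_measure, lintegral_smul_measure]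

/-- A decorated tree is given by its decorated root and the subtrees of the children. -/
def CarTree.equivSigma : CarTree ≃ Σ p : ℕ × ℕ, (Fin p.2 → CarTree) where
  toFun | .node ℓ k child => ⟨(ℓ, k), child⟩
  invFun p := .node p.1.1 p.1.2 p.2
  left_inv := by rintro ⟨⟩; rfl
  right_inv := by rintro ⟨⟨⟩, _⟩; rfl

/-- The branching property. -/
theorem lintegral_galtonWatson_eq_piSum (f : CarTree → ℝ≥0∞) :
    ∫⁻ T, f T ∂galtonWatson ν μ =
      ∫⁻ ℓ, ∫⁻ k, piSum (CarTree.weight ν μ) k (fun c => f (.node ℓ k c)) ∂ν ∂μ := by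
  simp only [lintegral_countable']
  rw [lintegral_galtonWatson, ← CarTree.equivSigma.symm.tsum_eq]
  refine (ENNReal.tsum_sigma' _).trans ?_
  refine (ENNReal.tsum_prod (f := fun ℓ k => ∑' c : Fin k → CarTree,
    (CarTree.node ℓ k c).weight ν μ * f (.node ℓ k c))).trans ?_
  refine tsum_congr fun ℓ => ?_
  rw [← ENNReal.tsum_mul_right]
  refine tsum_congr fun k => ?_
  rw [piSum, ← ENNReal.tsum_mul_right, ← ENNReal.tsum_mul_right]
  refine tsum_congr fun c => ?_
  simp only [CarTree.weight]
  ring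

/-- Separate `f` and `g` are needed: the root contributes through `visits` but its children through
`visits - 1`. -/
theorem lintegral_galtonWatson_prod {f g : CarTree → ℝ≥0∞} {h : ℕ → ℝ≥0∞}
    (hf : ∀ ℓ k c, f (.node ℓ k c) = h ℓ * ∏ i, g (c i)) :
    ∫⁻ T, f T ∂galtonWatson ν μ =
      (∫⁻ ℓ, h ℓ ∂μ) * ∫⁻ k, (∫⁻ T, g T ∂galtonWatson ν μ) ^ k ∂ν := by
  rw [lintegral_galtonWatson_eq_piSum]
  simp only [hf, piSum_const_mul, piSum_prod, ← lintegral_galtonWatson]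
  simp only [lintegral_const_mul _ (measurable_of_countable _)]
  rw [lintegral_mul_const _ (measurable_of_countable _)]

variable {ν μ} [IsProbabilityMeasure ν] [IsProbabilityMeasure μ]

theorem lintegral_galtonWatson_sum (hGW : galtonWatson ν μ Set.univ = 1) {f g : CarTree → ℝ≥0∞}
    (hf : ∀ ℓ k c, f (.node ℓ k c) = ℓ + ∑ i, g (c i)) :
    ∫⁻ T, f T ∂galtonWatson ν μ =
      ∫⁻ ℓ, (ℓ : ℝ≥0∞) ∂μ + (∫⁻ k, (k : ℝ≥0∞) ∂ν) * ∫⁻ T, g T ∂galtonWatson ν μ := by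
  have hw : ∑' T, CarTree.weight ν μ T = 1 := by
    rw [← hGW, ← lintegral_one, lintegral_galtonWatson]; simp
  rw [lintegral_galtonWatson_eq_piSum]
  simp only [hf, piSum_add, piSum_const hw, piSum_sum hw, ← lintegral_galtonWatson]
  simp only [lintegral_add_left (measurable_of_countable _), lintegral_const, measure_univ, mul_one,
    lintegral_mul_const _ (measurable_of_countable _)]

theorem lintegral_galtonWatson_sum_sq (hGW : galtonWatson ν μ Set.univ = 1) {f g : CarTree → ℝ≥0∞}
    (hf : ∀ ℓ k c, f (.node ℓ k c) = ℓ + ∑ i, g (c i)) :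
    ∫⁻ T, f T ^ 2 ∂galtonWatson ν μ =
      ∫⁻ ℓ, (ℓ : ℝ≥0∞) ^ 2 ∂μ +
      2 * (∫⁻ ℓ, (ℓ : ℝ≥0∞) ∂μ) * ((∫⁻ k, (k : ℝ≥0∞) ∂ν) * ∫⁻ T, g T ∂galtonWatson ν μ) +
      ((∫⁻ k, (k : ℝ≥0∞) ∂ν) * ∫⁻ T, g T ^ 2 ∂galtonWatson ν μ +
        (∫⁻ k, ((k * (k - 1) : ℕ) : ℝ≥0∞) ∂ν) * (∫⁻ T, g T ∂galtonWatson ν μ) ^ 2) := by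
  have hw : ∑' T, CarTree.weight ν μ T = 1 := by
    rw [← hGW, ← lintegral_one, lintegral_galtonWatson]; simp
  rw [lintegral_galtonWatson_eq_piSum]
  simp only [hf, add_sq, piSum_add, piSum_const hw, piSum_sum hw, piSum_const_mul, piSum_sum_sq hw,
    ← lintegral_galtonWatson]
  simp only [lintegral_add_left (measurable_of_countable _), lintegral_const, measure_univ, mul_one,
    lintegral_mul_const _ (measurable_of_countable _),
    lintegral_const_mul _ (measurable_of_countable _)]

theorem lintegral_pow_le_one {x : ℝ≥0∞} (hx : x ≤ 1) : ∫⁻ k, x ^ k ∂ν ≤ 1 :=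
  calc ∫⁻ k, x ^ k ∂ν ≤ ∫⁻ _, 1 ∂ν := lintegral_mono fun k => pow_le_one₀ (zero_le) hx
    _ = 1 := by simp

variable (ν μ)

/-- The law is a sum of weights over finite trees, so even total mass at most `1` needs proof. The
mass up to height `n` iterates the generating function of `ν` from `0`, and this function preserves
the unit interval. -/
theorem galtonWatson_height_le_le_one (n : ℕ) : galtonWatson ν μ {T | T.height ≤ n} ≤ 1 := by
  classical
  induction n with
  | zero =>
    have : {T : CarTree | T.height ≤ 0} = ∅ := by
      ext T; cases T; simp [CarTree.height]
    rw [this]; simp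
  | succ n ih =>
    rw [← lintegral_indicator_one (MeasurableSet.of_discrete)] at ih ⊢
    rw [lintegral_galtonWatson_prod (g := Set.indicator {T | T.height ≤ n} 1) (h := fun _ => 1)]
    · simpa using lintegral_pow_le_one ih
    · intro ℓ k c
      simp only [Set.indicator_apply, CarTree.height, Set.mem_ofPred_eq, add_le_add_iff_right,
        Finset.sup_le_iff, Finset.mem_univ, forall_const, Pi.one_apply, one_mul,
        Finset.prod_ite_zero, Finset.prod_const_one]

theorem galtonWatson_univ_le_one : galtonWatson ν μ Set.univ ≤ 1 := by
  have : (Set.univ : Set CarTree) = ⋃ n, {T : CarTree | T.height ≤ n} := by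
    ext T; simpa using ⟨T.height, le_rfl⟩
  have hmono : Monotone fun n => {T : CarTree | T.height ≤ n} := fun a b hab T hT => le_trans hT hab
  rw [this, hmono.measure_iUnion]
  exact iSup_le (galtonWatson_height_le_le_one ν μ)

omit [IsProbabilityMeasure ν] in
theorem galtonWatson_univ_eq :
    galtonWatson ν μ Set.univ = ∫⁻ k, (galtonWatson ν μ Set.univ) ^ k ∂ν := by
  have := lintegral_galtonWatson_prod ν μ (f := fun _ => 1) (g := fun _ => 1) (h := fun _ => 1)
    (by simp)
  simpa using this

end Branching

/-! ### Second-order expansion of generating functions -/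

/-- The second-order remainder `((1 - d) ^ k - 1 + k d) / d ^ 2`. -/
def powRem : ℕ → ℝ → ℝ
  | 0, _ => 0
  | k + 1, d => (1 - d) * powRem k d + k

theorem one_sub_pow_eq (k : ℕ) (d : ℝ) : (1 - d) ^ k = 1 - k * d + d ^ 2 * powRem k d := by
  induction k with
  | zero => simp [powRem]
  | succ k ih => rw [pow_succ, ih, powRem]; push_cast; ring

theorem powRem_nonneg (k : ℕ) {d : ℝ} (hd : d ∈ Set.Icc (0 : ℝ) 1) : 0 ≤ powRem k d := by
  induction k with
  | zero => simp [powRem]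
  | succ k ih => exact add_nonneg (mul_nonneg (sub_nonneg.2 hd.2) ih) k.cast_nonneg

/-- The bound is uniform in `d` and integrable under a finite second moment, hence serves as the
dominating function as `d → 0`. -/
theorem powRem_le (k : ℕ) {d : ℝ} (hd : d ∈ Set.Icc (0 : ℝ) 1) : powRem k d ≤ (k : ℝ) ^ 2 := by
  induction k with
  | zero => simp [powRem]
  | succ k ih =>
    have h0 := powRem_nonneg k hd
    have hk : (0 : ℝ) ≤ k := k.cast_nonneg
    rw [powRem]
    push_cast
    nlinarith [mul_nonneg hd.1 h0]

theorem powRem_pos {k : ℕ} (hk : 2 ≤ k) {d : ℝ} (hd : d ∈ Set.Icc (0 : ℝ) 1) : 0 < powRem k d := by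
  obtain ⟨j, rfl⟩ := Nat.exists_eq_add_of_le' hk
  have h0 := mul_nonneg (sub_nonneg.2 hd.2) (powRem_nonneg (j + 1) hd)
  rw [powRem]
  push_cast
  have : (0 : ℝ) ≤ j := j.cast_nonneg
  linarith

theorem powRem_zero_right (k : ℕ) : powRem k 0 = ((k : ℝ) ^ 2 - k) / 2 := by
  induction k with
  | zero => simp [powRem]
  | succ k ih => rw [powRem, ih]; push_cast; ring

theorem continuous_powRem (k : ℕ) : Continuous (powRem k) := by
  induction k with
  | zero => exact continuous_const
  | succ k ih =>
    change Continuous fun d => (1 - d) * powRem k d + k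
    fun_prop

section Moments
variable {ρ : Measure ℕ} [IsProbabilityMeasure ρ] (hρ : MemLp (fun k : ℕ => (k : ℝ)) 2 ρ)
include hρ

omit [IsProbabilityMeasure ρ] in
theorem integrable_natCast_sq : Integrable (fun k : ℕ => (k : ℝ) ^ 2) ρ := hρ.integrable_sq

theorem integrable_natCast : Integrable (fun k : ℕ => (k : ℝ)) ρ := hρ.integrable one_le_two

theorem integral_natCast_sq : ∫ k, (k : ℝ) ^ 2 ∂ρ = var ρ + mean ρ ^ 2 := by
  have := variance_eq_sub hρ
  rw [var, this, mean]
  simp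

omit [IsProbabilityMeasure ρ] in
theorem integrable_powRem {d : ℝ} (hd : d ∈ Set.Icc (0 : ℝ) 1) :
    Integrable (fun k => powRem k d) ρ := by
  refine (integrable_natCast_sq hρ).mono' (measurable_of_countable _).aestronglyMeasurable
    (ae_of_all _ fun k => ?_)
  rw [Real.norm_of_nonneg (powRem_nonneg k hd)]
  exact powRem_le k hd

theorem integral_one_sub_pow {d : ℝ} (hd : d ∈ Set.Icc (0 : ℝ) 1) :
    ∫ k, (1 - d) ^ k ∂ρ = 1 - mean ρ * d + d ^ 2 * ∫ k, powRem k d ∂ρ := by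
  simp only [one_sub_pow_eq]
  rw [integral_add, integral_sub, integral_const_mul, integral_mul_const, mean]
  · simp
  · exact integrable_const _
  · exact (integrable_natCast hρ).mul_const _
  · exact (integrable_const _).sub ((integrable_natCast hρ).mul_const _)
  · exact (integrable_powRem hρ hd).const_mul _

theorem integral_powRem_zero : ∫ k, powRem k 0 ∂ρ = (var ρ + mean ρ ^ 2 - mean ρ) / 2 := by
  simp only [powRem_zero_right]
  rw [integral_div, integral_sub (integrable_natCast_sq hρ) (integrable_natCast hρ),
    integral_natCast_sq hρ, mean]

theorem tendsto_integral_powRem :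
    Tendsto (fun d => ∫ k, powRem k d ∂ρ) (𝓝[Set.Icc 0 1] 0)
      (𝓝 ((var ρ + mean ρ ^ 2 - mean ρ) / 2)) := by
  rw [← integral_powRem_zero hρ]
  refine tendsto_integral_filter_of_dominated_convergence (fun k : ℕ => (k : ℝ) ^ 2)
    (.of_forall fun d => (measurable_of_countable _).aestronglyMeasurable) ?_
    (integrable_natCast_sq hρ)
    (ae_of_all _ fun k => (continuous_powRem k).continuousAt.tendsto.mono_left nhdsWithin_le_nhds)
  filter_upwards [self_mem_nhdsWithin] with d hd
  refine ae_of_all _ fun k => ?_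
  rw [Real.norm_of_nonneg (powRem_nonneg k hd)]
  exact powRem_le k hd

/-- A vanishing integral would confine `ρ` to `{0, 1}`, where mean `1` leaves only the Dirac mass at
`1`. -/
theorem integral_powRem_pos (hmean : mean ρ = 1) (hne : ρ ≠ Measure.dirac 1) {d : ℝ}
    (hd : d ∈ Set.Icc (0 : ℝ) 1) : 0 < ∫ k, powRem k d ∂ρ := by
  have h0 : 0 ≤ fun k => powRem k d := fun k => powRem_nonneg k hd
  refine lt_of_le_of_ne (integral_nonneg h0) fun h => hne ?_
  have h1 := (integral_eq_zero_iff_of_nonneg h0 (integrable_powRem hρ hd)).1 h.symm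
  have hle : ∀ᵐ k ∂ρ, k ≤ 1 := by
    filter_upwards [h1] with k hk
    by_contra h2
    exact (powRem_pos (by omega) hd).ne' hk
  have h2 : ∫ k, (1 - (k : ℝ)) ∂ρ = 0 := by
    rw [integral_sub (integrable_const _) (integrable_natCast hρ)]
    rw [mean] at hmean
    simp [hmean]
  have h3 := (integral_eq_zero_iff_of_nonneg_ae
    (by filter_upwards [hle] with k hk; simpa using hk)
    ((integrable_const _).sub (integrable_natCast hρ))).1 h2
  have h4 : id =ᵐ[ρ] fun _ => 1 := by
    filter_upwards [h3] with k hk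
    have : (1 : ℝ) - k = 0 := hk
    exact_mod_cast (sub_eq_zero.1 this).symm
  rw [← Measure.map_id (μ := ρ), Measure.map_congr h4, Measure.map_const]
  simp

theorem lintegral_natCast : ∫⁻ k, (k : ℝ≥0∞) ∂ρ = ENNReal.ofReal (mean ρ) := by
  rw [mean, ofReal_integral_eq_lintegral_ofReal (integrable_natCast hρ)
    (ae_of_all _ fun k => k.cast_nonneg)]
  simp

theorem lintegral_natCast_sq :
    ∫⁻ k, (k : ℝ≥0∞) ^ 2 ∂ρ = ENNReal.ofReal (var ρ + mean ρ ^ 2) := by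
  rw [← integral_natCast_sq hρ, ofReal_integral_eq_lintegral_ofReal (integrable_natCast_sq hρ)
    (ae_of_all _ fun k => sq_nonneg _)]
  simp [ENNReal.ofReal_pow]

theorem lintegral_natCast_mul_pred :
    ∫⁻ k, ((k * (k - 1) : ℕ) : ℝ≥0∞) ∂ρ = ENNReal.ofReal (var ρ + mean ρ ^ 2 - mean ρ) := by
  rw [← integral_natCast_sq hρ, mean,
    ← integral_sub (integrable_natCast_sq hρ) (integrable_natCast hρ)]
  have h : ∀ k : ℕ, (k : ℝ) ^ 2 - k = ((k * (k - 1) : ℕ) : ℝ) := by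
    intro k; cases k <;> simp; ring
  have hi : Integrable (fun k : ℕ => (k : ℝ) ^ 2 - k) ρ :=
    (integrable_natCast_sq hρ).sub (integrable_natCast hρ)
  rw [ofReal_integral_eq_lintegral_ofReal hi
    (ae_of_all _ fun k => by beta_reduce; rw [Pi.zero_apply, h]; exact Nat.cast_nonneg _)]
  simp only [h, ENNReal.ofReal_natCast]

end Moments

theorem lintegral_ofReal_pow {α : Type*} [MeasurableSpace α] [DiscreteMeasurableSpace α]
    (ρ : Measure α) [IsFiniteMeasure ρ] {x : ℝ} (hx : x ∈ Set.Icc (0 : ℝ) 1) (n : α → ℕ) :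
    ∫⁻ a, ENNReal.ofReal x ^ n a ∂ρ = ENNReal.ofReal (∫ a, x ^ n a ∂ρ) := by
  rw [ofReal_integral_eq_lintegral_ofReal _ (ae_of_all _ fun a => pow_nonneg hx.1 _)]
  · simp [ENNReal.ofReal_pow hx.1]
  · refine Integrable.of_bound (C := 1) Measurable.of_discrete.aestronglyMeasurable
      (ae_of_all _ fun a => ?_)
    rw [Real.norm_of_nonneg (pow_nonneg hx.1 _)]
    exact pow_le_one₀ hx.1 hx.2

/-- A critical Galton--Watson tree is almost surely finite. -/
theorem galtonWatson_univ {ν μ : Measure ℕ} [IsProbabilityMeasure ν] [IsProbabilityMeasure μ]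
    (hν : MemLp (fun k : ℕ => (k : ℝ)) 2 ν) (hmean : mean ν = 1) (hne : ν ≠ Measure.dirac 1) :
    galtonWatson ν μ Set.univ = 1 := by
  have hle := galtonWatson_univ_le_one ν μ
  have heq := galtonWatson_univ_eq ν μ
  set M := galtonWatson ν μ Set.univ
  have hfin : M ≠ ∞ := ne_top_of_le_ne_top ENNReal.one_ne_top hle
  set x := M.toReal with hx
  have hM : M = ENNReal.ofReal x := (ENNReal.ofReal_toReal hfin).symm
  have hx01 : x ∈ Set.Icc (0 : ℝ) 1 :=
    ⟨ENNReal.toReal_nonneg, by simpa using ENNReal.toReal_mono ENNReal.one_ne_top hle⟩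
  rw [hM, lintegral_ofReal_pow ν hx01, ENNReal.ofReal_eq_ofReal_iff hx01.1
    (integral_nonneg fun k => pow_nonneg hx01.1 _)] at heq
  have hd : 1 - x ∈ Set.Icc (0 : ℝ) 1 := ⟨by linarith [hx01.2], by linarith [hx01.1]⟩
  have h1 := integral_one_sub_pow hν hd
  rw [sub_sub_cancel, ← heq, hmean] at h1
  -- The total mass is a fixed point of the generating function; as the mean is `1`, only the
  -- strictly positive quadratic term survives, which forces `x = 1`.
  have h2 : (1 - x) ^ 2 * ∫ k, powRem k (1 - x) ∂ν = 0 := by linarith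
  have h3 := (mul_eq_zero.1 h2).resolve_right (integral_powRem_pos hν hmean hne hd).ne'
  rw [hM, show x = 1 by linarith [pow_eq_zero_iff two_ne_zero |>.1 h3]]
  simp

/-! ### Case `m ≤ 1`, `Θ ≥ 0`: the mean outflow is finite -/

variable {ν μ : Measure ℕ}

theorem lintegral_sub_one_add_measure_pos (P : Measure CarTree) (x : CarTree → ℕ) :
    ∫⁻ T, ((x T - 1 : ℕ) : ℝ≥0∞) ∂P + P {T | 0 < x T} = ∫⁻ T, (x T : ℝ≥0∞) ∂P := by
  rw [← lintegral_indicator_one MeasurableSet.of_discrete,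
    ← lintegral_add_left Measurable.of_discrete]
  refine lintegral_congr fun T => ?_
  rcases h : x T with _ | k <;> simp [h]

/-- Pointwise `x² = (x - 1)² + (x - 1) + x` for `x ≥ 1`, and truncated subtraction keeps it true at
`x = 0`. Written without subtraction, it holds for infinite moments too. -/
theorem lintegral_sub_one_sq (P : Measure CarTree) (x : CarTree → ℕ) :
    ∫⁻ T, ((x T - 1 : ℕ) : ℝ≥0∞) ^ 2 ∂P +
      (∫⁻ T, ((x T - 1 : ℕ) : ℝ≥0∞) ∂P + ∫⁻ T, (x T : ℝ≥0∞) ∂P) =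
        ∫⁻ T, (x T : ℝ≥0∞) ^ 2 ∂P := by
  rw [← lintegral_add_left Measurable.of_discrete, ← lintegral_add_left Measurable.of_discrete]
  refine lintegral_congr fun T => ?_
  rcases h : x T with _ | k
  · simp
  · simp; ring

/-- The expected number of cars that leave the tree through the root, with the arrivals at height
at least `n` discarded. -/
noncomputable def expectedOutflow (ν μ : Measure ℕ) (n : ℕ) : ℝ≥0∞ :=
  ∫⁻ T, ((T.visitsBelow n - 1 : ℕ) : ℝ≥0∞) ∂galtonWatson ν μ

theorem tendsto_expectedOutflow :
    Tendsto (expectedOutflow ν μ) atTop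
      (𝓝 (∫⁻ T, ((T.visits - 1 : ℕ) : ℝ≥0∞) ∂galtonWatson ν μ)) := by
  refine lintegral_tendsto_of_tendsto_of_monotone (fun n => Measurable.of_discrete.aemeasurable)
    (ae_of_all _ fun T a b hab => ?_) (ae_of_all _ fun T => ?_)
  · exact Nat.cast_le.2 (Nat.sub_le_sub_right (T.visitsBelow_mono hab) 1)
  · refine tendsto_const_nhds.congr' ?_
    filter_upwards [eventually_ge_atTop T.height] with n hn
    rw [T.visitsBelow_eq_visits hn]

section
variable [IsProbabilityMeasure ν] [IsProbabilityMeasure μ]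
  (hν : MemLp (fun k : ℕ => (k : ℝ)) 2 ν) (hmean : mean ν = 1)
  (hμ : MemLp (fun k : ℕ => (k : ℝ)) 2 μ) (hGW : galtonWatson ν μ Set.univ = 1)
include hν hmean hμ hGW

theorem lintegral_visitsBelow_succ (n : ℕ) :
    ∫⁻ T, (T.visitsBelow (n + 1) : ℝ≥0∞) ∂galtonWatson ν μ =
      ENNReal.ofReal (mean μ) + expectedOutflow ν μ n := by
  rw [lintegral_galtonWatson_sum hGW (g := fun T => ((T.visitsBelow n - 1 : ℕ) : ℝ≥0∞)),
    lintegral_natCast hν, lintegral_natCast hμ, hmean, ENNReal.ofReal_one, one_mul, expectedOutflow]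
  intro ℓ k c
  simp [CarTree.visitsBelow]

theorem lintegral_visits :
    ∫⁻ T, (T.visits : ℝ≥0∞) ∂galtonWatson ν μ =
      ENNReal.ofReal (mean μ) + ∫⁻ T, ((T.visits - 1 : ℕ) : ℝ≥0∞) ∂galtonWatson ν μ := by
  rw [lintegral_galtonWatson_sum hGW (g := fun T => ((T.visits - 1 : ℕ) : ℝ≥0∞)),
    lintegral_natCast hν, lintegral_natCast hμ, hmean, ENNReal.ofReal_one, one_mul]
  intro ℓ k c
  simp [CarTree.visits]

/-- The recursion for the second moments of the outflows. -/
theorem lintegral_outflow_sq_succ (n : ℕ) :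
    ∫⁻ T, ((T.visitsBelow (n + 1) - 1 : ℕ) : ℝ≥0∞) ^ 2 ∂galtonWatson ν μ +
      (expectedOutflow ν μ (n + 1) + (ENNReal.ofReal (mean μ) + expectedOutflow ν μ n)) =
    ∫⁻ T, ((T.visitsBelow n - 1 : ℕ) : ℝ≥0∞) ^ 2 ∂galtonWatson ν μ +
      (ENNReal.ofReal (var μ + mean μ ^ 2) +
        2 * ENNReal.ofReal (mean μ) * expectedOutflow ν μ n +
        ENNReal.ofReal (var ν) * expectedOutflow ν μ n ^ 2) := by
  rw [← lintegral_visitsBelow_succ hν hmean hμ hGW, expectedOutflow, lintegral_sub_one_sq,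
    lintegral_galtonWatson_sum_sq hGW (g := fun T => ((T.visitsBelow n - 1 : ℕ) : ℝ≥0∞)),
    lintegral_natCast hν, lintegral_natCast hμ, hmean, ENNReal.ofReal_one, one_mul, expectedOutflow,
    lintegral_natCast_sq hμ, lintegral_natCast_mul_pred hν, hmean]
  · simp only [one_pow, add_sub_cancel_right, one_mul]
    ring
  · intro ℓ k c
    simp [CarTree.visitsBelow]

theorem expectedOutflow_ne_top (n : ℕ) : expectedOutflow ν μ n ≠ ∞ := by
  induction n with
  | zero => simp [expectedOutflow, CarTree.visitsBelow]
  | succ n ih =>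
    refine ne_top_of_le_ne_top ?_ (lintegral_mono (g := fun T => (T.visitsBelow (n + 1) : ℝ≥0∞))
      fun T => Nat.cast_le.2 (Nat.sub_le _ 1))
    rw [lintegral_visitsBelow_succ hν hmean hμ hGW]
    finiteness

theorem lintegral_outflow_sq_ne_top (n : ℕ) :
    ∫⁻ T, ((T.visitsBelow n - 1 : ℕ) : ℝ≥0∞) ^ 2 ∂galtonWatson ν μ ≠ ∞ := by
  induction n with
  | zero => simp [CarTree.visitsBelow]
  | succ n ih =>
    have ha := expectedOutflow_ne_top hν hmean hμ hGW n
    refine ne_top_of_le_ne_top ?_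
      (le_self_add.trans_eq (lintegral_outflow_sq_succ hν hmean hμ hGW n))
    finiteness

theorem expectedOutflow_succ_le (n : ℕ) :
    (expectedOutflow ν μ (n + 1)).toReal + mean μ + (expectedOutflow ν μ n).toReal ≤
      var μ + mean μ ^ 2 + 2 * mean μ * (expectedOutflow ν μ n).toReal +
        var ν * (expectedOutflow ν μ n).toReal ^ 2 := by
  have hm : 0 ≤ mean μ := integral_nonneg fun k => k.cast_nonneg
  have hvμ : 0 ≤ var μ := variance_nonneg _ _
  have hvν : 0 ≤ var ν := variance_nonneg _ _
  have ha := expectedOutflow_ne_top hν hmean hμ hGW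
  have h := lintegral_outflow_sq_succ hν hmean hμ hGW n
  have hmono : ∫⁻ T, ((T.visitsBelow n - 1 : ℕ) : ℝ≥0∞) ^ 2 ∂galtonWatson ν μ ≤
      ∫⁻ T, ((T.visitsBelow (n + 1) - 1 : ℕ) : ℝ≥0∞) ^ 2 ∂galtonWatson ν μ := by
    refine lintegral_mono fun T => ?_
    gcongr
    exact T.visitsBelow_mono n.le_succ
  -- Finiteness of the truncated second moment is what allows it to be cancelled.
  have h1 := ENNReal.le_of_add_le_add_left (lintegral_outflow_sq_ne_top hν hmean hμ hGW n)
    ((add_le_add_left hmono _).trans_eq h)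
  rw [← ENNReal.ofReal_toReal (ha (n + 1)), ← ENNReal.ofReal_toReal (ha n)] at h1
  set a := (expectedOutflow ν μ n).toReal
  set a' := (expectedOutflow ν μ (n + 1)).toReal
  have h0 : 0 ≤ a := ENNReal.toReal_nonneg
  have h0' : 0 ≤ a' := ENNReal.toReal_nonneg
  rw [← ENNReal.ofReal_ofNat 2, ← ENNReal.ofReal_mul (by norm_num), ← ENNReal.ofReal_mul (by positivity),
    ← ENNReal.ofReal_pow h0, ← ENNReal.ofReal_mul hvν, ← ENNReal.ofReal_add hm h0,
    ← ENNReal.ofReal_add h0' (by positivity), ← ENNReal.ofReal_add (by positivity) (by positivity),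
    ← ENNReal.ofReal_add (by positivity) (by positivity),
    ENNReal.ofReal_le_ofReal_iff (by positivity)] at h1
  linarith

/-- The mean outflow stays bounded when the discriminant `Θ` is nonnegative. -/
theorem expectedOutflow_le (hvar : 0 < var ν) (hm1 : mean μ ≤ 1) (hΘ : 0 ≤ theta ν μ) (n : ℕ) :
    (expectedOutflow ν μ n).toReal ≤ (1 - mean μ) / var ν := by
  have hm : 0 ≤ mean μ := integral_nonneg fun k => k.cast_nonneg
  induction n with
  | zero =>
    simp only [expectedOutflow, CarTree.visitsBelow]
    simpa using div_nonneg (sub_nonneg.2 hm1) hvar.le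
  | succ n ih =>
    have h := expectedOutflow_succ_le hν hmean hμ hGW n
    set a := (expectedOutflow ν μ n).toReal
    have h0 : 0 ≤ a := ENNReal.toReal_nonneg
    set A := (1 - mean μ) / var ν with hA
    have hvA : var ν * A = 1 - mean μ := by rw [hA]; field_simp
    -- This is `Θ ≥ 0` divided by `Σ²`.
    have h1 : var μ + mean μ ^ 2 - mean μ ≤ (1 - mean μ) * A := by
      rw [hA, mul_div_assoc', le_div_iff₀ hvar]
      rw [theta] at hΘ
      linarith
    -- Uses `a ≤ A`. The recursion is then bounded by `(1 - m) A + m a ≤ A`.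
    have h2 : var ν * a ^ 2 ≤ (1 - mean μ) * a := by
      rw [← hvA]; nlinarith [mul_nonneg hvar.le h0]
    have h3 : mean μ * a ≤ mean μ * A := mul_le_mul_of_nonneg_left ih hm
    linarith

theorem galtonWatson_visits_pos_eq (hvar : 0 < var ν) (hm1 : mean μ ≤ 1) (hΘ : 0 ≤ theta ν μ) :
    galtonWatson ν μ {T | 0 < T.visits} = ENNReal.ofReal (mean μ) := by
  have hle : ∫⁻ T, ((T.visits - 1 : ℕ) : ℝ≥0∞) ∂galtonWatson ν μ ≤
      ENNReal.ofReal ((1 - mean μ) / var ν) :=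
    le_of_tendsto' tendsto_expectedOutflow fun n =>
      (ENNReal.le_ofReal_iff_toReal_le (expectedOutflow_ne_top hν hmean hμ hGW n)
        (div_nonneg (sub_nonneg.2 hm1) hvar.le)).2
        (expectedOutflow_le hν hmean hμ hGW hvar hm1 hΘ n)
  have h := lintegral_sub_one_add_measure_pos (galtonWatson ν μ) CarTree.visits
  rw [lintegral_visits hν hmean hμ hGW, add_comm] at h
  -- The mean outflow, now known to be finite, cancels from `E Z + q = m + E Z`.
  exact (ENNReal.add_left_inj (ne_top_of_le_ne_top ENNReal.ofReal_ne_top hle)).1 h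

end

/-! ### Generating functions: `q ≤ m`, with equality only if `Θ ≥ 0` -/

section
/-- `1 - E[(1 - ε) ^ Z]`, where `Z` is the outflow from the root. -/
noncomputable def outflowDefect (ν μ : Measure ℕ) (ε : ℝ) : ℝ :=
  1 - ∫ T, (1 - ε) ^ (CarTree.visits T - 1) ∂galtonWatson ν μ

theorem outflowDefect_mem [IsProbabilityMeasure (galtonWatson ν μ)] {ε : ℝ}
    (hε : ε ∈ Set.Icc (0 : ℝ) 1) : outflowDefect ν μ ε ∈ Set.Icc (0 : ℝ) 1 := by
  have h0 : ∀ n : ℕ, 0 ≤ (1 - ε) ^ n := fun n => pow_nonneg (by linarith [hε.2]) _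
  have h1 : ∀ n : ℕ, (1 - ε) ^ n ≤ 1 := fun n =>
    pow_le_one₀ (by linarith [hε.2]) (by linarith [hε.1])
  refine ⟨sub_nonneg.2 ?_, sub_le_self _ (integral_nonneg fun T => h0 _)⟩
  refine (integral_mono_of_nonneg (ae_of_all _ fun T => h0 _) (integrable_const 1)
    (ae_of_all _ fun T => h1 _)).trans_eq ?_
  simp

theorem tendsto_outflowDefect [IsProbabilityMeasure (galtonWatson ν μ)] :
    Tendsto (outflowDefect ν μ) (𝓝[Set.Icc 0 1] 0) (𝓝[Set.Icc 0 1] 0) := by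
  refine tendsto_nhdsWithin_iff.2 ⟨?_, by
    filter_upwards [self_mem_nhdsWithin] with ε hε using outflowDefect_mem hε⟩
  have h : Tendsto (fun ε : ℝ => ∫ T, (1 - ε) ^ (CarTree.visits T - 1) ∂galtonWatson ν μ)
      (𝓝[Set.Icc 0 1] 0) (𝓝 (∫ _, (1 : ℝ) ∂galtonWatson ν μ)) := by
    refine tendsto_integral_filter_of_dominated_convergence (fun _ => 1)
      (.of_forall fun _ => Measurable.of_discrete.aestronglyMeasurable) ?_ (integrable_const 1)
      (ae_of_all _ fun T => ?_)
    · filter_upwards [self_mem_nhdsWithin] with ε hε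
      refine ae_of_all _ fun T => ?_
      rw [Real.norm_of_nonneg (pow_nonneg (by linarith [hε.2]) _)]
      exact pow_le_one₀ (by linarith [hε.2]) (by linarith [hε.1])
    · have : ContinuousAt (fun ε : ℝ => (1 - ε) ^ (CarTree.visits T - 1)) 0 := by fun_prop
      simpa using this.tendsto.mono_left (nhdsWithin_le_nhds (s := Set.Icc 0 1))
  have := (tendsto_const_nhds (x := (1 : ℝ))).sub h
  simp only [integral_const, probReal_univ, smul_eq_mul, mul_one, sub_self] at this
  exact this

/-- `z * z ^ (X - 1) = z ^ X` unless `X = 0`, where truncation gives `z` in place of `1`; the second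
term repairs this on an event of probability `1 - q`. -/
theorem integral_pow_visits_add [IsProbabilityMeasure (galtonWatson ν μ)] {z : ℝ}
    (hz : z ∈ Set.Icc (0 : ℝ) 1) :
    z * ∫ T, z ^ (CarTree.visits T - 1) ∂galtonWatson ν μ +
        (1 - (galtonWatson ν μ).real {T | 0 < T.visits}) * (1 - z) =
      ∫ T, z ^ CarTree.visits T ∂galtonWatson ν μ := by
  have hi : ∀ n : CarTree → ℕ, Integrable (fun T => z ^ n T) (galtonWatson ν μ) := fun n =>
    Integrable.of_bound (C := 1) Measurable.of_discrete.aestronglyMeasurable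
      (ae_of_all _ fun a => by
        rw [Real.norm_of_nonneg (pow_nonneg hz.1 _)]
        exact pow_le_one₀ hz.1 hz.2)
  rw [← probReal_compl_eq_one_sub MeasurableSet.of_discrete, mul_comm (Measure.real _ _),
    ← smul_eq_mul (1 - z), ← integral_indicator_one MeasurableSet.of_discrete, smul_eq_mul,
    ← integral_const_mul, ← integral_const_mul, ← integral_add ((hi _).const_mul _)]
  · refine integral_congr_ae (ae_of_all _ fun T => ?_)
    rcases h : T.visits with _ | k
    · simp [h]
    · simp [h, pow_succ']
  · exact (Integrable.indicator (integrable_const 1) MeasurableSet.of_discrete).const_mul _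

variable [IsProbabilityMeasure ν] [IsProbabilityMeasure μ]
  (hν : MemLp (fun k : ℕ => (k : ℝ)) 2 ν) (hmean : mean ν = 1)
  (hμ : MemLp (fun k : ℕ => (k : ℝ)) 2 μ)

theorem integral_pow_visits [IsProbabilityMeasure (galtonWatson ν μ)] {z : ℝ}
    (hz : z ∈ Set.Icc (0 : ℝ) 1) :
    ∫ T, z ^ CarTree.visits T ∂galtonWatson ν μ =
      (∫ ℓ, z ^ ℓ ∂μ) * ∫ k, (∫ T, z ^ (CarTree.visits T - 1) ∂galtonWatson ν μ) ^ k ∂ν := by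
  have hF : ∫ T, z ^ (CarTree.visits T - 1) ∂galtonWatson ν μ ∈ Set.Icc (0 : ℝ) 1 := by
    have := outflowDefect_mem (ν := ν) (μ := μ) (ε := 1 - z)
      ⟨by linarith [hz.2], by linarith [hz.1]⟩
    rw [outflowDefect, sub_sub_cancel] at this
    exact ⟨by linarith [this.2], by linarith [this.1]⟩
  have h := lintegral_galtonWatson_prod ν μ (f := fun T => ENNReal.ofReal z ^ T.visits)
    (g := fun T => ENNReal.ofReal z ^ (T.visits - 1)) (h := fun ℓ => ENNReal.ofReal z ^ ℓ)
    (fun ℓ k c => by simp [CarTree.visits, pow_add, Finset.prod_pow_eq_pow_sum])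
  rw [lintegral_ofReal_pow _ hz, lintegral_ofReal_pow _ hz, lintegral_ofReal_pow _ hz,
    lintegral_ofReal_pow _ hF,
    ← ENNReal.ofReal_mul (integral_nonneg fun k => pow_nonneg hz.1 _),
    ENNReal.ofReal_eq_ofReal_iff (integral_nonneg fun k => pow_nonneg hz.1 _)
    (mul_nonneg (integral_nonneg fun k => pow_nonneg hz.1 _)
      (integral_nonneg fun k => pow_nonneg hF.1 _))] at h
  exact h

include hν hmean hμ

/-- The second-order expansion of the functional equation of the generating functions. -/
theorem outflowDefect_eq [IsProbabilityMeasure (galtonWatson ν μ)] {ε : ℝ}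
    (hε : ε ∈ Set.Icc (0 : ℝ) 1) :
    ε * (mean μ - (galtonWatson ν μ).real {T | 0 < T.visits}) +
        (1 - mean μ) * ε * outflowDefect ν μ ε =
      outflowDefect ν μ ε ^ 2 * ((∫ k, powRem k (outflowDefect ν μ ε) ∂ν) * (1 - mean μ * ε)) +
      ε ^ 2 * ((∫ ℓ, powRem ℓ ε ∂μ) * ∫ k, (1 - outflowDefect ν μ ε) ^ k ∂ν) := by
  have hz : 1 - ε ∈ Set.Icc (0 : ℝ) 1 := ⟨by linarith [hε.2], by linarith [hε.1]⟩
  have h := (integral_pow_visits_add (ν := ν) (μ := μ) hz).trans (integral_pow_visits hz)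
  have hd := outflowDefect_mem (ν := ν) (μ := μ) hε
  have hF : ∫ T, (1 - ε) ^ (CarTree.visits T - 1) ∂galtonWatson ν μ = 1 - outflowDefect ν μ ε := by
    rw [outflowDefect, sub_sub_cancel]
  rw [hF, integral_one_sub_pow hμ hε, integral_one_sub_pow hν hd, hmean] at h
  rw [integral_one_sub_pow hν hd, hmean]
  linear_combination h

/-- Divide the expansion by `ε`: its right side is nonnegative, and `outflowDefect` vanishes in the
limit, leaving `m - q ≥ 0`. -/
theorem galtonWatson_real_visits_pos_le [IsProbabilityMeasure (galtonWatson ν μ)] :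
    (galtonWatson ν μ).real {T | 0 < T.visits} ≤ mean μ := by
  have hle : 𝓝[>] (0 : ℝ) ≤ 𝓝[Set.Icc 0 1] 0 := by
    rw [← nhdsWithin_Ioc_eq_nhdsGT zero_lt_one]
    exact nhdsWithin_mono _ Set.Ioc_subset_Icc_self
  have hlim : Tendsto (fun ε => mean μ - (galtonWatson ν μ).real {T | 0 < T.visits} +
      (1 - mean μ) * outflowDefect ν μ ε) (𝓝[>] 0)
      (𝓝 (mean μ - (galtonWatson ν μ).real {T | 0 < T.visits} + (1 - mean μ) * 0)) :=
    (((tendsto_outflowDefect.mono_right nhdsWithin_le_nhds).mono_left hle).const_mul _).const_add _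
  -- The mean of `μ` may exceed `1`, so this sign is only available near `0`.
  have hsmall : ∀ᶠ ε : ℝ in 𝓝[>] 0, 0 ≤ 1 - mean μ * ε := by
    have : Tendsto (fun ε : ℝ => 1 - mean μ * ε) (𝓝[>] 0) (𝓝 (1 - mean μ * 0)) :=
      (Continuous.tendsto (by fun_prop) 0).mono_left nhdsWithin_le_nhds
    exact (this.eventually (lt_mem_nhds (by simp))).mono fun _ h => h.le
  have h0 := ge_of_tendsto hlim (b := 0) (by
    filter_upwards [hsmall, self_mem_nhdsWithin, hle self_mem_nhdsWithin] with ε h1 h2 h3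
    have h := outflowDefect_eq hν hmean hμ h3
    have hd := outflowDefect_mem (ν := ν) (μ := μ) h3
    have hA : 0 ≤ ∫ k, powRem k (outflowDefect ν μ ε) ∂ν := integral_nonneg fun k => powRem_nonneg k hd
    have hB : 0 ≤ ∫ ℓ, powRem ℓ ε ∂μ := integral_nonneg fun k => powRem_nonneg k h3
    have hC : 0 ≤ ∫ k, (1 - outflowDefect ν μ ε) ^ k ∂ν :=
      integral_nonneg fun k => pow_nonneg (by linarith [hd.2]) _
    have h4 : 0 ≤ ε * (mean μ - (galtonWatson ν μ).real {T | 0 < T.visits} +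
      (1 - mean μ) * outflowDefect ν μ ε) := by
      rw [mul_add, ← mul_assoc, mul_comm ε (1 - mean μ), h]
      positivity
    exact nonneg_of_mul_nonneg_right h4 h2)
  linarith

theorem theta_nonneg_of_galtonWatson_real_visits_pos_eq [IsProbabilityMeasure (galtonWatson ν μ)]
    (hq : (galtonWatson ν μ).real {T | 0 < T.visits} = mean μ) : 0 ≤ theta ν μ := by
  have hle : 𝓝[>] (0 : ℝ) ≤ 𝓝[Set.Icc 0 1] 0 := by
    rw [← nhdsWithin_Ioc_eq_nhdsGT zero_lt_one]
    exact nhdsWithin_mono _ Set.Ioc_subset_Icc_self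
  have hδ := (tendsto_outflowDefect (ν := ν) (μ := μ)).mono_left hle
  have hδ0 := hδ.mono_right nhdsWithin_le_nhds
  have hΦ := (tendsto_integral_powRem hν).comp hδ
  have hG := (tendsto_integral_powRem hμ).mono_left hle
  have hφ : Tendsto (fun ε => ∫ k, (1 - outflowDefect ν μ ε) ^ k ∂ν) (𝓝[>] 0) (𝓝 1) := by
    have h := ((hδ0.const_mul (mean ν)).const_sub 1).add ((hδ0.pow 2).mul hΦ)
    simp only [mul_zero, sub_zero, ne_eq, OfNat.ofNat_ne_zero, not_false_eq_true, zero_pow, zero_mul,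
      add_zero] at h
    refine h.congr' ?_
    filter_upwards [hle self_mem_nhdsWithin] with ε hε
    exact (integral_one_sub_pow hν (outflowDefect_mem hε)).symm
  have hε : Tendsto (fun ε : ℝ => 1 - mean μ * ε) (𝓝[>] 0) (𝓝 1) := by
    simpa using (Continuous.tendsto (f := fun ε : ℝ => 1 - mean μ * ε) (by fun_prop) 0).mono_left
      (nhdsWithin_le_nhds (s := Set.Ioi 0))
  -- The factor `4` absorbs the two halves in the limits of the remainders, so the limit is `Θ`.
  have hlim := (((hΦ.mul hε).mul (hG.mul hφ)).const_mul 4).const_sub ((1 - mean μ) ^ 2)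
  have h0 := ge_of_tendsto hlim (b := 0) (by
    filter_upwards [self_mem_nhdsWithin, hle self_mem_nhdsWithin] with ε h2 h3
    have h := outflowDefect_eq hν hmean hμ h3
    rw [hq, sub_self, mul_zero, zero_add] at h
    simp only [Function.comp_apply]
    set δ := outflowDefect ν μ ε
    set A := (∫ k, powRem k δ ∂ν) * (1 - mean μ * ε)
    set B := (∫ ℓ, powRem ℓ ε ∂μ) * ∫ k, (1 - δ) ^ k ∂ν
    have h2' : 0 < ε := h2
    have h5 : 0 ≤ ε ^ 2 * ((1 - mean μ) ^ 2 - 4 * (A * B)) := by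
      -- Completing the square, after multiplying the quadratic relation by `4 A`, avoids dividing
      -- by `A`.
      have : ε ^ 2 * ((1 - mean μ) ^ 2 - 4 * (A * B)) = (2 * A * δ - (1 - mean μ) * ε) ^ 2 := by
        linear_combination 4 * A * h
      rw [this]; positivity
    exact nonneg_of_mul_nonneg_right h5 (by positivity))
  rw [theta]
  rw [hmean] at h0
  linarith

end

end Parking

theorem proposition3p2 (ν μ : Measure ℕ) [IsProbabilityMeasure ν] [IsProbabilityMeasure μ]
    (hν_var : MemLp (fun k : ℕ => (k : ℝ)) 2 ν) (hν_mean : Parking.mean ν = 1)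
    (hν_ne : ν ≠ Measure.dirac 1)
    (hμ_var : MemLp (fun k : ℕ => (k : ℝ)) 2 μ) (hμ_mean : 0 < Parking.mean μ)
    (hμ_ne : μ ≠ Measure.dirac 1) :
    (Parking.mean μ ≤ 1 → 0 ≤ Parking.theta ν μ →
      Parking.galtonWatson ν μ {T | T.RootOccupied} = ENNReal.ofReal (Parking.mean μ)) ∧
    (Parking.theta ν μ < 0 ∨ 1 < Parking.mean μ →
      Parking.galtonWatson ν μ {T | T.RootOccupied} < ENNReal.ofReal (Parking.mean μ)) := by
  have hGW := Parking.galtonWatson_univ (μ := μ) hν_var hν_mean hν_ne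
  have : IsProbabilityMeasure (Parking.galtonWatson ν μ) := ⟨hGW⟩
  have hvar : 0 < Parking.var ν := by
    -- At `d = 0` the integral is half the variance of `ν`, since the mean is `1`.
    have h := Parking.integral_powRem_pos hν_var hν_mean hν_ne (d := 0) (by simp)
    rw [Parking.integral_powRem_zero hν_var, hν_mean] at h
    linarith
  simp only [Parking.CarTree.rootOccupied_iff]
  refine ⟨Parking.galtonWatson_visits_pos_eq hν_var hν_mean hμ_var hGW hvar, fun h => ?_⟩
  rw [← ofReal_measureReal, ENNReal.ofReal_lt_ofReal_iff hμ_mean]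
  rcases h with hΘ | hm
  · exact lt_of_le_of_ne (Parking.galtonWatson_real_visits_pos_le hν_var hν_mean hμ_var) fun hq =>
      hΘ.not_ge (Parking.theta_nonneg_of_galtonWatson_real_visits_pos_eq hν_var hν_mean hμ_var hq)
  · exact measureReal_le_one.trans_lt hm
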